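/- For $k\ge 1$ and positive integers $s_1,\dots,s_k$ put $$\delta_{s_1,\dots,s_k}:=\sum_{n_1>n_2>\cdots>n_k\ge 1}\frac{2^{-n_1}}{n_1^{s_1}\cdots n_k^{s_k}},$$ and, if moreover $s_1\ge 2$, $$\zeta_{s_1,\dots,s_k}:=\sum_{n_1>n_2>\cdots>n_k\ge 1}\frac{1}{n_1^{s_1}\cdots n_k^{s_k}},$$ the sums being over integers. All these series converge, and $$3\zeta_{4,1}+\zeta_{3,2}=\delta_{3,2}+3\delta_{4,1}+\left(\tfrac12\delta_2^2+\delta_{3,1}\right)\ln 2+\left[\tfrac12(\ln 2)^2+\zeta_2\right]\delta_{2,1}-3\delta_{3,1,1}-2\delta_{2,2,1}-\delta_{2,1,2}+\tfrac14\zeta_2(\ln 2)^3 .$$ -/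

import Mathlib

/-- The index set of the nested sums: tuples of integers `n₁ > n₂ > ⋯ > n_{k+1} ≥ 1`
(here `n i` with `i : Fin (k + 1)` is the entry number `i + 1`; the depth is `k + 1 ≥ 1`). -/
def decreasingTuples (k : ℕ) : Set (Fin (k + 1) → ℕ) :=
  {n | StrictAnti n ∧ ∀ i, 1 ≤ n i}

/-- The term `z ^ n₁ / (n₁ ^ s₁ ⋯ n_{k+1} ^ s_{k+1})`. -/
noncomputable def polylogTerm {k : ℕ} (s : Fin (k + 1) → ℕ) (z : ℝ)
    (n : decreasingTuples k) : ℝ :=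
  z ^ (n.1 0) / ∏ i, (n.1 i : ℝ) ^ (s i)

/-- The term `1 / (n₁ ^ s₁ ⋯ n_{k+1} ^ s_{k+1})`. -/
noncomputable def mzvTerm {k : ℕ} (s : Fin (k + 1) → ℕ) (n : decreasingTuples k) : ℝ :=
  1 / ∏ i, (n.1 i : ℝ) ^ (s i)

/-- The single-variable multiple polylogarithm
`Li_{s₁,…,s_{k+1}}(z) = ∑_{n₁ > ⋯ > n_{k+1} ≥ 1} z ^ n₁ / (n₁ ^ s₁ ⋯ n_{k+1} ^ s_{k+1})`. -/
noncomputable def multiPolylog {k : ℕ} (s : Fin (k + 1) → ℕ) (z : ℝ) : ℝ :=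
  ∑' n : decreasingTuples k, polylogTerm s z n

/-- The delta value `δ_{s₁,…,s_{k+1}} = Li_{s₁,…,s_{k+1}}(1/2)`. -/
noncomputable def deltaValue {k : ℕ} (s : Fin (k + 1) → ℕ) : ℝ :=
  multiPolylog s (1 / 2)

/-- The multiple zeta value
`ζ_{s₁,…,s_{k+1}} = ∑_{n₁ > ⋯ > n_{k+1} ≥ 1} 1 / (n₁ ^ s₁ ⋯ n_{k+1} ^ s_{k+1})`. -/
noncomputable def multiZeta {k : ℕ} (s : Fin (k + 1) → ℕ) : ℝ :=
  ∑' n : decreasingTuples k, mzvTerm s n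

open Filter Topology
open scoped ENNReal

/-! Each nested sum is an iterated integral of a word in dt/t and dt/(1-t), and two relations
between such integrals give the identity. The shuffle formula `wordPolylog_mul_wordPolylog`
linearises products at a common point. The Hölder convolution `wordConvolution_eq_tsum` cuts the
integral over 0 < t₁ < ⋯ < 1 at x; the substitution t ↦ 1 - t swaps the two forms and reverses the
word on the outer piece, so a zeta value becomes a sum of products of values at 1 - x and x. At x =
1/2 both arguments agree: ζ(4,1), ζ(3,2), ζ(2) become polynomials in delta values and ln 2. Six
shuffle relations then reduce the claim to linear algebra. Integrals are handled as power series: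
both formulas follow by comparing derivatives, with boundary values at 0 or 1. -/

/-- The coefficients of the iterated integral, over `0 < t₁ < ⋯ < x`, of the word in the forms
`dt / t` (letter `false`) and `dt / (1 - t)` (letter `true`); the head of the word is the
outermost form. -/
noncomputable def wordCoeff : List Bool → ℕ → ℝ
  | [], n => if n = 0 then 1 else 0
  | false :: w, n => wordCoeff w n / n
  | true :: w, n => (∑ m ∈ Finset.range n, wordCoeff w m) / n

/-- The iterated integral of a word, as a power series. -/
noncomputable def wordPolylog (w : List Bool) (x : ℝ) : ℝ :=
  ∑' n, wordCoeff w n * x ^ n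

/-! ### Size of the coefficients and summability -/

theorem wordCoeff_nonneg (w : List Bool) (n : ℕ) : 0 ≤ wordCoeff w n := by
  induction w generalizing n with
  | nil => simp only [wordCoeff]; split_ifs <;> norm_num
  | cons b w ih =>
    cases b
    · exact div_nonneg (ih n) n.cast_nonneg
    · exact div_nonneg (Finset.sum_nonneg fun m _ => ih m) n.cast_nonneg

theorem wordCoeff_le_one (w : List Bool) (n : ℕ) : wordCoeff w n ≤ 1 := by
  induction w generalizing n with
  | nil => simp only [wordCoeff]; split_ifs <;> norm_num
  | cons b w ih =>
    rcases Nat.eq_zero_or_pos n with rfl | hn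
    · cases b <;> simp [wordCoeff]
    have hn' : (1 : ℝ) ≤ n := by exact_mod_cast hn
    cases b
    · rw [wordCoeff, div_le_one (by linarith)]
      exact (ih n).trans hn'
    · rw [wordCoeff, div_le_one (by linarith)]
      simpa using Finset.sum_le_sum fun m (_ : m ∈ Finset.range n) => ih m

theorem wordCoeff_cons_zero (b : Bool) (w : List Bool) : wordCoeff (b :: w) 0 = 0 := by
  cases b <;> simp [wordCoeff]

theorem sum_range_one_div_sqrt_le (n : ℕ) :
    ∑ m ∈ Finset.range n, 1 / √((m : ℝ) + 1) ≤ 2 * √(n : ℝ) := by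
  induction n with
  | zero => simp
  | succ n ih =>
    rw [Finset.sum_range_succ]
    push_cast
    have h1 : 0 < √((n : ℝ) + 1) := Real.sqrt_pos.2 (by positivity)
    have h2 : √((n : ℝ) + 1) ^ 2 = n + 1 := Real.sq_sqrt (by positivity)
    have h3 : √(n : ℝ) ^ 2 = n := Real.sq_sqrt (by positivity)
    have h4 : 1 / √((n : ℝ) + 1) ≤ 2 * √((n : ℝ) + 1) - 2 * √(n : ℝ) := by
      rw [div_le_iff₀ h1]
      nlinarith [sq_nonneg (√((n : ℝ) + 1) - √(n : ℝ))]
    linarith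

/-- The order n^(-1/2) survives both letters: the partial sums of 1/√m are at most 2√n, and division
by n restores the decay. This crude bound avoids powers of log n, yet yields the null sequence
needed for Abel's theorem and summability after one more division by n. -/
theorem exists_wordCoeff_le_div_sqrt (w : List Bool) :
    ∃ C : ℝ, 0 ≤ C ∧ ∀ n : ℕ, wordCoeff w n ≤ C / √((n : ℝ) + 1) := by
  induction w with
  | nil =>
    refine ⟨1, zero_le_one, fun n => ?_⟩
    rcases Nat.eq_zero_or_pos n with rfl | hn
    · simp [wordCoeff]
    · simp only [wordCoeff, hn.ne', if_false]; positivity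
  | cons b w ih =>
    obtain ⟨C, hC, h⟩ := ih
    cases b
    · refine ⟨C, hC, fun n => ?_⟩
      rcases Nat.eq_zero_or_pos n with rfl | hn
      · simp [wordCoeff, hC]
      · exact (div_le_self (wordCoeff_nonneg w n) (by exact_mod_cast hn)).trans (h n)
    · refine ⟨4 * C, by positivity, fun n => ?_⟩
      rcases Nat.eq_zero_or_pos n with rfl | hn
      · simp [wordCoeff, hC]
      have hn' : (1 : ℝ) ≤ n := by exact_mod_cast hn
      have h0 : ∑ m ∈ Finset.range n, wordCoeff w m ≤ C * (2 * √(n : ℝ)) := by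
        refine le_trans ?_ (mul_le_mul_of_nonneg_left (sum_range_one_div_sqrt_le n) hC)
        rw [Finset.mul_sum]
        exact Finset.sum_le_sum fun m _ => (h m).trans_eq (by ring)
      have h1 : 0 < √((n : ℝ) + 1) := Real.sqrt_pos.2 (by positivity)
      have h3 : √(n : ℝ) ^ 2 = n := Real.sq_sqrt (by positivity)
      have h4 : √((n : ℝ) + 1) ≤ 2 * √(n : ℝ) := by
        rw [Real.sqrt_le_iff]
        exact ⟨by positivity, by nlinarith⟩
      rw [wordCoeff, div_le_div_iff₀ (by linarith) h1]
      calc _ ≤ C * (2 * √(n : ℝ)) * (2 * √(n : ℝ)) := by gcongr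
        _ = 4 * C * √(n : ℝ) ^ 2 := by ring
        _ = 4 * C * n := by rw [h3]

theorem tendsto_wordCoeff (w : List Bool) : Tendsto (wordCoeff w) atTop (𝓝 0) := by
  obtain ⟨C, -, h⟩ := exists_wordCoeff_le_div_sqrt w
  refine squeeze_zero (wordCoeff_nonneg w) h (Tendsto.div_atTop tendsto_const_nhds ?_)
  exact Real.tendsto_sqrt_atTop.comp
    (tendsto_atTop_add_const_right _ _ tendsto_natCast_atTop_atTop)

theorem summable_wordCoeff_false_cons (w : List Bool) : Summable (wordCoeff (false :: w)) := by
  obtain ⟨C, hC, h⟩ := exists_wordCoeff_le_div_sqrt w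
  have hs : Summable fun n : ℕ => C * (1 / (n : ℝ) ^ (3 / 2 : ℝ)) :=
    (Real.summable_one_div_nat_rpow.2 (by norm_num)).mul_left C
  refine hs.of_nonneg_of_le (wordCoeff_nonneg _) fun n => ?_
  rcases Nat.eq_zero_or_pos n with rfl | hn
  · simp [wordCoeff]
  have hn' : (0 : ℝ) < n := by exact_mod_cast hn
  have h1 : (n : ℝ) ^ (3 / 2 : ℝ) = √(n : ℝ) * n := by
    rw [Real.sqrt_eq_rpow, ← Real.rpow_add_one hn'.ne']; norm_num
  rw [wordCoeff, h1, mul_one_div, ← div_div]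
  gcongr
  refine (h n).trans ?_
  gcongr
  linarith

theorem summable_wordCoeff_mul_pow (w : List Bool) {x : ℝ} (hx : |x| < 1) :
    Summable fun n => ‖wordCoeff w n * x ^ n‖ := by
  refine (summable_geometric_of_lt_one (abs_nonneg x) hx).of_nonneg_of_le
    (fun n => norm_nonneg _) fun n => ?_
  rw [norm_mul, norm_pow, Real.norm_eq_abs, Real.norm_eq_abs, abs_of_nonneg (wordCoeff_nonneg w n)]
  exact mul_le_of_le_one_left (by positivity) (wordCoeff_le_one w n)

/-! ### Differential equations of the word series -/

theorem wordPolylog_nil (x : ℝ) : wordPolylog [] x = 1 := by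
  rw [wordPolylog, tsum_eq_single 0]
  · simp [wordCoeff]
  · intro n hn; simp [wordCoeff, hn]

theorem wordPolylog_cons_zero (b : Bool) (w : List Bool) : wordPolylog (b :: w) 0 = 0 := by
  rw [wordPolylog]
  convert tsum_zero with n
  rcases Nat.eq_zero_or_pos n with rfl | hn
  · simp [wordCoeff_cons_zero]
  · simp [hn.ne']

theorem hasDerivAt_wordPolylog (w : List Bool) {x : ℝ} (hx : |x| < 1) :
    HasDerivAt (wordPolylog w) (∑' n : ℕ, wordCoeff w n * (n * x ^ (n - 1))) x := by
  obtain ⟨r, hxr, hr⟩ := exists_between hx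
  have hr0 : 0 ≤ r := (abs_nonneg x).trans hxr.le
  have hs : Summable fun n : ℕ => (n : ℝ) * r ^ (n - 1) := by
    rw [← summable_nat_add_iff 1]
    have h1 := summable_pow_mul_geometric_of_norm_lt_one 1
      (show ‖r‖ < 1 by rwa [Real.norm_of_nonneg hr0])
    have h2 := summable_geometric_of_lt_one hr0 hr
    refine (h1.add h2).congr fun n => ?_
    push_cast; simp; ring
  refine hasDerivAt_tsum_of_isPreconnected (t := Metric.ball 0 r) (y₀ := 0)
    (g := fun n y => wordCoeff w n * y ^ n) (g' := fun n y => wordCoeff w n * (n * y ^ (n - 1)))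
    hs Metric.isOpen_ball
    (convex_ball _ _).isPreconnected (fun n y _ => (hasDerivAt_pow n y).const_mul _)
    (fun n y hy => ?_) (Metric.mem_ball_self ((abs_nonneg x).trans_lt hxr))
    (summable_wordCoeff_mul_pow w (by simp)).of_norm (by simpa using hxr)
  have hy' : |y| ≤ r := by simpa using (Metric.mem_ball.1 hy).le
  rw [norm_mul, norm_mul, norm_pow, Real.norm_eq_abs, Real.norm_eq_abs, Real.norm_eq_abs,
    abs_of_nonneg (wordCoeff_nonneg w n), Nat.abs_cast]
  refine (mul_le_of_le_one_left (by positivity) (wordCoeff_le_one w n)).trans ?_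
  gcongr

/-- Cauchy product with the geometric series turns coefficients into partial sums. -/
theorem hasDerivAt_wordPolylog_true_cons (w : List Bool) {x : ℝ} (hx : |x| < 1) :
    HasDerivAt (wordPolylog (true :: w)) (wordPolylog w x / (1 - x)) x := by
  convert hasDerivAt_wordPolylog (true :: w) hx using 1
  have h1 := tsum_mul_tsum_eq_tsum_sum_range_of_summable_norm
    (summable_wordCoeff_mul_pow w hx) (summable_norm_geometric_of_norm_lt_one (r := x) hx)
  rw [tsum_geometric_of_norm_lt_one hx] at h1
  rw [div_eq_mul_inv, wordPolylog, h1]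
  have h0 : (fun n : ℕ => wordCoeff (true :: w) n * (n * x ^ (n - 1))) 0 = 0 := by simp
  rw [← Function.Injective.tsum_eq (g := Nat.succ) Nat.succ_injective
    (f := fun n : ℕ => wordCoeff (true :: w) n * (n * x ^ (n - 1)))]
  · refine tsum_congr fun n => ?_
    simp only [wordCoeff, Nat.succ_eq_add_one, Nat.add_sub_cancel]
    have hn : ((n + 1 : ℕ) : ℝ) ≠ 0 := by positivity
    rw [div_mul_eq_mul_div, mul_left_comm, mul_div_cancel_left₀ _ hn, Finset.sum_mul]
    refine Finset.sum_congr rfl fun m hm => ?_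
    rw [mul_assoc, ← pow_add, Nat.add_sub_cancel' (Nat.lt_succ_iff.1 (Finset.mem_range.1 hm))]
  · intro n hn
    rcases n with _ | n
    · exact absurd h0 hn
    · exact ⟨n, rfl⟩

/-- The inner word is nonempty, so its series has no constant term and can be divided by x. -/
theorem hasDerivAt_wordPolylog_false_cons (b : Bool) (w : List Bool) {x : ℝ} (hx : |x| < 1)
    (hx0 : x ≠ 0) :
    HasDerivAt (wordPolylog (false :: b :: w)) (wordPolylog (b :: w) x / x) x := by
  convert hasDerivAt_wordPolylog (false :: b :: w) hx using 1
  rw [wordPolylog, ← tsum_div_const]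
  refine tsum_congr fun n => ?_
  rw [wordCoeff]
  rcases n with _ | n
  · simp [wordCoeff_cons_zero]
  · have hn : ((n + 1 : ℕ) : ℝ) ≠ 0 := by positivity
    rw [Nat.add_sub_cancel, pow_succ]
    field_simp

/-- The last letter of the word is not `dt / t`, so that its iterated integral converges at `0`. -/
def ConvergentAtZero : List Bool → Prop
  | [] => True
  | [b] => b = true
  | _ :: b :: w => ConvergentAtZero (b :: w)

theorem ConvergentAtZero.tail {b : Bool} {w : List Bool} (h : ConvergentAtZero (b :: w)) :
    ConvergentAtZero w := by
  cases w
  · trivial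
  · exact h

theorem ConvergentAtZero.cons {w : List Bool} (h : ConvergentAtZero w) (hw : w ≠ []) (b : Bool) :
    ConvergentAtZero (b :: w) := by
  cases w
  · exact absurd rfl hw
  · exact h

/-- The density of the form of a letter: `1 / x` or `1 / (1 - x)`. -/
noncomputable def letterDensity (b : Bool) (x : ℝ) : ℝ :=
  if b then (1 - x)⁻¹ else x⁻¹

theorem letterDensity_one_sub (b : Bool) (x : ℝ) :
    letterDensity b (1 - x) = letterDensity (!b) x := by
  cases b <;> simp [letterDensity]

theorem hasDerivAt_wordPolylog_cons {b : Bool} {w : List Bool} (h : ConvergentAtZero (b :: w))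
    {x : ℝ} (hx0 : 0 < x) (hx1 : x < 1) :
    HasDerivAt (wordPolylog (b :: w)) (wordPolylog w x * letterDensity b x) x := by
  have hx : |x| < 1 := by rwa [abs_of_pos hx0]
  cases b
  · cases w with
    | nil => simp [ConvergentAtZero] at h
    | cons c w =>
      simpa [letterDensity, div_eq_mul_inv] using
        hasDerivAt_wordPolylog_false_cons c w hx hx0.ne'
  · simpa [letterDensity, div_eq_mul_inv] using hasDerivAt_wordPolylog_true_cons w hx

theorem continuousAt_wordPolylog (w : List Bool) {x : ℝ} (hx : |x| < 1) :
    ContinuousAt (wordPolylog w) x :=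
  (hasDerivAt_wordPolylog w hx).continuousAt

/-! ### Shuffle product -/

/-- The words, with multiplicity, that are shuffles of two words. -/
def wordShuffle : List Bool → List Bool → List (List Bool)
  | [], v => [v]
  | a :: u, [] => [a :: u]
  | a :: u, b :: v =>
    (wordShuffle u (b :: v)).map (a :: ·) ++ (wordShuffle (a :: u) v).map (b :: ·)
termination_by u v => u.length + v.length

theorem ConvergentAtZero.of_mem_wordShuffle (u v : List Bool) (hu : ConvergentAtZero u)
    (hv : ConvergentAtZero v) :
    ∀ w ∈ wordShuffle u v, ConvergentAtZero w ∧ w.length = u.length + v.length := by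
  induction u, v using wordShuffle.induct with
  | case1 v => simpa [wordShuffle] using hv
  | case2 a u => simpa [wordShuffle] using hu
  | case3 a u b v ih1 ih2 =>
    intro w hw
    rw [wordShuffle, List.mem_append, List.mem_map, List.mem_map] at hw
    rcases hw with ⟨w, hw, rfl⟩ | ⟨w, hw, rfl⟩
    · obtain ⟨h1, h2⟩ := ih1 hu.tail hv w hw
      refine ⟨h1.cons ?_ a, by simp [h2]; ring⟩
      rintro rfl
      simp at h2
    · obtain ⟨h1, h2⟩ := ih2 hu hv.tail w hw
      refine ⟨h1.cons ?_ b, by simp [h2]; ring⟩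
      rintro rfl
      simp only [List.length_nil, List.length_cons] at h2
      omega

theorem hasDerivAt_sum_map_wordPolylog_cons (b : Bool) (l : List (List Bool))
    (h : ∀ w ∈ l, ConvergentAtZero (b :: w)) {x : ℝ} (hx0 : 0 < x) (hx1 : x < 1) :
    HasDerivAt (fun y => ((l.map (b :: ·)).map (wordPolylog · y)).sum)
      ((l.map (wordPolylog · x)).sum * letterDensity b x) x := by
  induction l with
  | nil => simpa using hasDerivAt_const x (0 : ℝ)
  | cons w l ih =>
    simp only [List.map_cons, List.sum_cons, add_mul]
    exact (hasDerivAt_wordPolylog_cons (h w (by simp)) hx0 hx1).add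
      (ih fun v hv => h v (by simp [hv]))

theorem continuousAt_sum_map_wordPolylog (l : List (List Bool)) {x : ℝ} (hx : |x| < 1) :
    ContinuousAt (fun y => (l.map (wordPolylog · y)).sum) x := by
  induction l with
  | nil => simpa using continuousAt_const
  | cons w l ih =>
    simp only [List.map_cons, List.sum_cons]
    exact (continuousAt_wordPolylog w hx).add ih

theorem sum_map_wordPolylog_cons_zero (b : Bool) (l : List (List Bool)) :
    ((l.map (b :: ·)).map (wordPolylog · 0)).sum = 0 := by
  induction l with
  | nil => simp
  | cons w l ih => simpa [wordPolylog_cons_zero] using ih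

/-- The shuffle product formula. -/
theorem wordPolylog_mul_wordPolylog (u v : List Bool) (hu : ConvergentAtZero u)
    (hv : ConvergentAtZero v) {x : ℝ} (hx0 : 0 ≤ x) (hx1 : x < 1) :
    wordPolylog u x * wordPolylog v x = ((wordShuffle u v).map (wordPolylog · x)).sum := by
  induction u, v using wordShuffle.induct generalizing x with
  | case1 v => simp [wordShuffle, wordPolylog_nil]
  | case2 a u => simp [wordShuffle, wordPolylog_nil]
  | case3 a u b v ih1 ih2 =>
    -- By the Leibniz rule and the two induction hypotheses, both sides have the same derivative on
    -- the open interval; both vanish at 0.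
    set F : ℝ → ℝ := fun y => wordPolylog (a :: u) y * wordPolylog (b :: v) y -
      ((((wordShuffle u (b :: v)).map (a :: ·)).map (wordPolylog · y)).sum +
        (((wordShuffle (a :: u) v).map (b :: ·)).map (wordPolylog · y)).sum) with hF
    suffices h : F x = 0 by
      rw [wordShuffle, List.map_append, List.sum_append]
      exact sub_eq_zero.1 h
    have hF0 : F 0 = 0 := by
      simp only [hF, sum_map_wordPolylog_cons_zero, wordPolylog_cons_zero]; ring
    rcases hx0.eq_or_lt with rfl | hx0
    · exact hF0
    have hcont : ContinuousOn F (Set.Icc 0 x) := by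
      intro y hy
      have hy' : |y| < 1 := by rw [abs_of_nonneg hy.1]; exact hy.2.trans_lt hx1
      exact (((continuousAt_wordPolylog _ hy').mul (continuousAt_wordPolylog _ hy')).sub
        ((continuousAt_sum_map_wordPolylog _ hy').add
          (continuousAt_sum_map_wordPolylog _ hy'))).continuousWithinAt
    have hderiv : ∀ y ∈ Set.Ioo 0 x, HasDerivAt F 0 y := by
      intro y hy
      have hy1 : y < 1 := hy.2.trans hx1
      have h1 := hasDerivAt_sum_map_wordPolylog_cons a (wordShuffle u (b :: v)) (fun w hw => by
        obtain ⟨h1, h2⟩ := ConvergentAtZero.of_mem_wordShuffle _ _ hu.tail hv w hw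
        exact h1.cons (by rintro rfl; simp at h2) a) hy.1 hy1
      have h2 := hasDerivAt_sum_map_wordPolylog_cons b (wordShuffle (a :: u) v) (fun w hw => by
        obtain ⟨h1, h2⟩ := ConvergentAtZero.of_mem_wordShuffle _ _ hu hv.tail w hw
        exact h1.cons (by rintro rfl; simp only [List.length_nil, List.length_cons] at h2; omega) b) hy.1 hy1
      rw [← ih1 hu.tail hv hy.1.le hy1] at h1
      rw [← ih2 hu hv.tail hy.1.le hy1] at h2
      refine (((hasDerivAt_wordPolylog_cons hu hy.1 hy1).mul
        (hasDerivAt_wordPolylog_cons hv hy.1 hy1)).sub (h1.add h2)).congr_deriv ?_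
      ring
    -- The mean value theorem needs only continuity at 0, where the density 1/x is singular.
    obtain ⟨c, -, hc⟩ := exists_hasDerivAt_eq_slope F (fun _ => 0) hx0 hcont hderiv
    rw [hF0, sub_zero, sub_zero, eq_comm, div_eq_zero_iff] at hc
    exact hc.resolve_right hx0.ne'

/-! ### Hölder convolution -/

/-- The sum of the products `L (r' ++ r) (1 - x) * L v' x` over the splittings of `v` into a
prefix, with dual word `r'`, and a suffix `v'`. -/
noncomputable def wordConvolution : List Bool → List Bool → ℝ → ℝ
  | r, [], x => wordPolylog r (1 - x)
  | r, b :: v, x => wordPolylog r (1 - x) * wordPolylog (b :: v) x + wordConvolution ((!b) :: r) v x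

/-- The sum telescopes: differentiating the right factor of one product cancels differentiating the
left factor of the next, since the dual letter at 1 - x has the density of the letter at x. Only the
left derivative of the first product remains. -/
theorem hasDerivAt_wordConvolution (c : Bool) (r v : List Bool) (hr : ConvergentAtZero (c :: r))
    (hv : ConvergentAtZero v) {x : ℝ} (hx0 : 0 < x) (hx1 : x < 1) :
    HasDerivAt (wordConvolution (c :: r) v)
      (-(wordPolylog r (1 - x) * letterDensity (!c) x * wordPolylog v x)) x := by
  have key : ∀ (c : Bool) (r : List Bool), ConvergentAtZero (c :: r) →
      HasDerivAt (fun y => wordPolylog (c :: r) (1 - y))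
        (-(wordPolylog r (1 - x) * letterDensity (!c) x)) x := by
    intro c r hr
    have h := hasDerivAt_wordPolylog_cons hr (sub_pos.2 hx1) (sub_lt_self 1 hx0)
    rw [letterDensity_one_sub] at h
    exact (h.comp x ((hasDerivAt_id x).const_sub 1)).congr_deriv (by ring)
  induction v generalizing c r with
  | nil => exact (key c r hr).congr_deriv (by rw [wordPolylog_nil, mul_one])
  | cons b v ih =>
    have h := ((key c r hr).mul (hasDerivAt_wordPolylog_cons hv hx0 hx1)).add
      (ih (!b) (c :: r) (hr.cons (by simp) _) hv.tail)
    rw [Bool.not_not] at h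
    exact h.congr_deriv (by ring)

theorem hasDerivAt_wordConvolution_nil (v : List Bool) (hv : ConvergentAtZero (false :: v))
    {x : ℝ} (hx0 : 0 < x) (hx1 : x < 1) :
    HasDerivAt (wordConvolution [] (false :: v)) 0 x := by
  have h := (hasDerivAt_wordPolylog_cons hv hx0 hx1).add
    (hasDerivAt_wordConvolution true [] v rfl hv.tail hx0 hx1)
  have h1 : wordConvolution [] (false :: v) =
      wordPolylog (false :: v) + wordConvolution [true] v := by
    funext y
    simp [wordConvolution, wordPolylog_nil]
  rw [h1]
  refine h.congr_deriv ?_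
  rw [wordPolylog_nil, Bool.not_true]
  ring

/-- Abel's theorem. -/
theorem tendsto_one_sub_mul_wordPolylog (w : List Bool) :
    Tendsto (fun x => (1 - x) * wordPolylog w x) (𝓝[<] 1) (𝓝 0) := by
  -- These are the coefficients of (1 - x) times the series; their partial sums telescope to
  -- `wordCoeff w n`, which tends to 0.
  set f : ℕ → ℝ := fun n => wordCoeff w n - if n = 0 then 0 else wordCoeff w (n - 1) with hf
  have hsum : ∀ n, ∑ i ∈ Finset.range (n + 1), f i = wordCoeff w n := by
    intro n
    induction n with
    | zero => simp [hf]
    | succ n ih => rw [Finset.sum_range_succ, ih]; simp [hf]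
  have h := Real.tendsto_tsum_powerSeries_nhdsWithin_lt (f := f) (l := 0)
    ((tendsto_add_atTop_iff_nat 1).1 (by simpa only [hsum] using tendsto_wordCoeff w))
  refine h.congr' ?_
  filter_upwards [Ioo_mem_nhdsLT (zero_lt_one' ℝ)] with x hx
  have hs := (summable_wordCoeff_mul_pow w
    (show |x| < 1 by rw [abs_of_pos hx.1]; exact hx.2)).of_norm
  have h1 : HasSum (fun n => (if n = 0 then 0 else wordCoeff w (n - 1)) * x ^ n)
      (x * wordPolylog w x) := by
    rw [← hasSum_nat_add_iff' 1]
    simpa [pow_succ, mul_comm, mul_left_comm, wordPolylog] using hs.hasSum.mul_left x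
  have h2 := (hs.hasSum.sub h1).tsum_eq
  rw [sub_mul, one_mul]
  refine (tsum_congr fun n => ?_).trans h2
  simp only [hf]; ring

theorem wordPolylog_nonneg (w : List Bool) {x : ℝ} (hx : 0 ≤ x) : 0 ≤ wordPolylog w x :=
  tsum_nonneg fun n => mul_nonneg (wordCoeff_nonneg w n) (pow_nonneg hx n)

theorem wordPolylog_cons_le (b : Bool) (w : List Bool) {x : ℝ} (hx0 : 0 ≤ x) (hx1 : x < 1) :
    wordPolylog (b :: w) x ≤ x * (1 - x)⁻¹ := by
  have hx : |x| < 1 := by rwa [abs_of_nonneg hx0]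
  have hs := (summable_wordCoeff_mul_pow (b :: w) hx).of_norm
  rw [wordPolylog, hs.tsum_eq_zero_add, wordCoeff_cons_zero, zero_mul, zero_add,
    ← tsum_geometric_of_lt_one hx0 hx1, ← tsum_mul_left]
  refine ((summable_nat_add_iff 1).2 hs).tsum_le_tsum (fun n => ?_)
    ((summable_geometric_of_lt_one hx0 hx1).mul_left x)
  rw [pow_succ, mul_comm x]
  exact mul_le_of_le_one_left (by positivity) (wordCoeff_le_one _ _)

/-- The first factor is O(1 - x) and the second is o(1/(1 - x)). -/
theorem tendsto_wordPolylog_mul_wordPolylog (c : Bool) (r v : List Bool) :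
    Tendsto (fun x => wordPolylog (c :: r) (1 - x) * wordPolylog v x) (𝓝[<] 1) (𝓝 0) := by
  have h : Tendsto (fun x : ℝ => x⁻¹ * ((1 - x) * wordPolylog v x)) (𝓝[<] 1) (𝓝 0) := by
    simpa using ((tendsto_inv₀ (one_ne_zero (α := ℝ))).mono_left nhdsWithin_le_nhds).mul
      (tendsto_one_sub_mul_wordPolylog v)
  refine squeeze_zero' ?_ ?_ h
  · filter_upwards [Ioo_mem_nhdsLT (zero_lt_one' ℝ)] with x hx
    exact mul_nonneg (wordPolylog_nonneg _ (by linarith [hx.2])) (wordPolylog_nonneg _ hx.1.le)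
  · filter_upwards [Ioo_mem_nhdsLT (zero_lt_one' ℝ)] with x hx
    have h1 := wordPolylog_cons_le c r (x := 1 - x) (by linarith [hx.2]) (by linarith [hx.1])
    rw [sub_sub_cancel] at h1
    calc _ ≤ (1 - x) * x⁻¹ * wordPolylog v x := by
          gcongr; exact wordPolylog_nonneg _ hx.1.le
      _ = _ := by ring

theorem tendsto_wordConvolution (c : Bool) (r v : List Bool) :
    Tendsto (wordConvolution (c :: r) v) (𝓝[<] 1) (𝓝 0) := by
  induction v generalizing c r with
  | nil => simpa [wordConvolution, wordPolylog_nil] using tendsto_wordPolylog_mul_wordPolylog c r []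
  | cons b v ih =>
    simpa [wordConvolution] using
      (tendsto_wordPolylog_mul_wordPolylog c r (b :: v)).add (ih (!b) (c :: r))

/-- The Hölder convolution formula. -/
theorem wordConvolution_eq_tsum (v : List Bool) (hv : ConvergentAtZero (false :: v)) {x : ℝ}
    (hx0 : 0 < x) (hx1 : x < 1) :
    wordConvolution [] (false :: v) x = ∑' n, wordCoeff (false :: v) n := by
  have h1 : Tendsto (wordPolylog (false :: v)) (𝓝[<] 1) (𝓝 (∑' n, wordCoeff (false :: v) n)) :=
    Real.tendsto_tsum_powerSeries_nhdsWithin_lt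
      (summable_wordCoeff_false_cons v).hasSum.tendsto_sum_nat
  have h2 := h1.add (tendsto_wordConvolution true [] v)
  rw [add_zero] at h2
  -- The convolution is constant on (0, 1); as the point tends to 1, only the product with empty
  -- prefix survives.
  refine tendsto_nhds_unique (tendsto_const_nhds.congr' ?_) h2
  filter_upwards [Ioo_mem_nhdsLT (zero_lt_one' ℝ)] with y hy
  have h3 : wordConvolution [] (false :: v) x = wordConvolution [] (false :: v) y := by
    refine isOpen_Ioo.is_const_of_deriv_eq_zero (s := Set.Ioo (0 : ℝ) 1)
      (convex_Ioo _ _).isPreconnected (fun z hz => ?_) (fun z hz => ?_) ⟨hx0, hx1⟩ hy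
    · exact (hasDerivAt_wordConvolution_nil v hv hz.1 hz.2).differentiableAt.differentiableWithinAt
    · exact (hasDerivAt_wordConvolution_nil v hv hz.1 hz.2).deriv
  rw [h3]
  simp [wordConvolution, wordPolylog_nil]

/-! ### Nested sums as word series -/

/-- The word of an index `s`: the blocks of `s i - 1` letters `dt / t` and one `dt / (1 - t)`. -/
def indexWord : List ℕ → List Bool
  | [] => []
  | a :: s => List.replicate (a - 1) false ++ true :: indexWord s

theorem wordCoeff_replicate_append (j : ℕ) (w : List Bool) (n : ℕ) :
    wordCoeff (List.replicate j false ++ w) n = wordCoeff w n / (n : ℝ) ^ j := by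
  induction j with
  | zero => simp
  | succ j ih =>
    rw [List.replicate_succ, List.cons_append, wordCoeff, ih, div_div, ← pow_succ]

theorem wordCoeff_indexWord_cons {a : ℕ} (ha : 1 ≤ a) (s : List ℕ) (n : ℕ) :
    wordCoeff (indexWord (a :: s)) n =
      (∑ m ∈ Finset.range n, wordCoeff (indexWord s) m) / (n : ℝ) ^ a := by
  rw [indexWord, wordCoeff_replicate_append, wordCoeff, div_div, ← pow_succ',
    Nat.sub_add_cancel ha]

theorem cons_mem_decreasingTuples {k : ℕ} (N : ℕ) (n : Fin (k + 1) → ℕ) :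
    (Fin.cons N n : Fin (k + 2) → ℕ) ∈ decreasingTuples (k + 1) ↔
      n ∈ decreasingTuples k ∧ n 0 < N := by
  have h : StrictAnti (Fin.cons N n : Fin (k + 2) → ℕ) ↔ n 0 < N ∧ StrictAnti n := by
    rw [Fin.strictAnti_iff_succ_lt, Fin.forall_fin_succ, Fin.strictAnti_iff_succ_lt]
    simp
  simp only [decreasingTuples, Set.mem_ofPred_eq, h, Fin.forall_fin_succ (n := k + 1),
    Fin.cons_zero, Fin.cons_succ]
  constructor
  · rintro ⟨⟨h1, h2⟩, -, h4⟩
    exact ⟨⟨h2, h4⟩, h1⟩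
  · rintro ⟨⟨h2, h4⟩, h1⟩
    exact ⟨⟨h1, h2⟩, by omega, h4⟩

/-- The factor `1 / (n₁ ^ s₁ ⋯ n_{k+1} ^ s_{k+1})`, extended by zero to all tuples. -/
noncomputable def tupleWeight {k : ℕ} (s n : Fin (k + 1) → ℕ) : ℝ≥0∞ :=
  (decreasingTuples k).indicator (fun n => ENNReal.ofReal (1 / ∏ i, (n i : ℝ) ^ s i)) n

theorem tupleWeight_cons {k : ℕ} (s : Fin (k + 2) → ℕ) (N : ℕ) (n : Fin (k + 1) → ℕ) :
    tupleWeight s (Fin.cons N n) =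
      if n 0 < N then ENNReal.ofReal (1 / (N : ℝ) ^ s 0) * tupleWeight (Fin.tail s) n else 0 := by
  classical
  simp only [tupleWeight, Set.indicator_apply, cons_mem_decreasingTuples]
  by_cases h1 : n ∈ decreasingTuples k <;> by_cases h2 : n 0 < N <;> simp only [h1, h2, and_self,
    and_true, and_false, if_true, if_false, mul_zero]
  rw [← ENNReal.ofReal_mul (by positivity), Fin.prod_univ_succ, one_div_mul_one_div]
  rfl

/-- The weight g is arbitrary so that the induction can peel off the largest entry N and take the
indicator of m < N as the next weight. Values in `ℝ≥0∞` make every rearrangement free. -/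
theorem tsum_mul_tupleWeight (k : ℕ) (s : Fin (k + 1) → ℕ) (hs : ∀ i, 1 ≤ s i) (g : ℕ → ℝ≥0∞) :
    ∑' n, g (n 0) * tupleWeight s n =
      ∑' N, g N * ENNReal.ofReal (wordCoeff (indexWord (List.ofFn s)) N) := by
  induction k generalizing g with
  | zero =>
    rw [← (Equiv.funUnique (Fin 1) ℕ).symm.tsum_eq]
    refine tsum_congr fun N => ?_
    rw [List.ofFn_succ, wordCoeff_indexWord_cons (hs 0)]
    congr 1
    simp only [tupleWeight, Set.indicator_apply, decreasingTuples, Set.mem_ofPred_eq]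
    rcases Nat.eq_zero_or_pos N with rfl | hN
    · simp
    -- The empty word has its only coefficient at 0, so this sum is 1 exactly when N ≥ 1, which
    -- encodes the bound on the innermost entry.
    · have h1 : ∑ m ∈ Finset.range N, wordCoeff [] m = 1 := by
        simp [wordCoeff, hN]
      simp [indexWord, h1, Nat.one_le_iff_ne_zero.2 hN.ne', Subsingleton.strictAnti]
  | succ k ih =>
    have h1 : ∀ N, ∑' n : Fin (k + 1) → ℕ, g N * tupleWeight s (Fin.cons N n) =
        g N * (ENNReal.ofReal (1 / (N : ℝ) ^ s 0) *
          ∑' n : Fin (k + 1) → ℕ, (if n 0 < N then 1 else 0) * tupleWeight (Fin.tail s) n) := by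
      intro N
      rw [ENNReal.tsum_mul_left, ← ENNReal.tsum_mul_left (a := ENNReal.ofReal _)]
      congr 1
      refine tsum_congr fun n => ?_
      rw [tupleWeight_cons]
      split_ifs <;> simp
    rw [← (Fin.consEquiv fun _ => ℕ).tsum_eq, ENNReal.tsum_prod']
    refine tsum_congr fun N => ?_
    change ∑' n : Fin (k + 1) → ℕ, g N * tupleWeight s (Fin.cons N n) = _
    rw [h1, ih (Fin.tail s) (fun i => hs _) fun m => if m < N then 1 else 0]
    congr 1
    rw [List.ofFn_succ (f := s), wordCoeff_indexWord_cons (hs 0), tsum_eq_sum (s := Finset.range N)]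
    · rw [div_eq_mul_one_div (Finset.sum _ _), mul_comm (Finset.sum _ _), ENNReal.ofReal_mul (by positivity),
        ENNReal.ofReal_sum_of_nonneg fun m _ => wordCoeff_nonneg _ _]
      congr 1
      refine Finset.sum_congr rfl fun m hm => ?_
      rw [if_pos (Finset.mem_range.1 hm), one_mul]
      rfl
    · intro m hm
      rw [if_neg (by simpa using hm), zero_mul]

theorem tsum_ofReal_polylogTerm {k : ℕ} (s : Fin (k + 1) → ℕ) (hs : ∀ i, 1 ≤ s i) {z : ℝ}
    (hz : 0 ≤ z) :
    ∑' n, ENNReal.ofReal (polylogTerm s z n) =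
      ∑' N, ENNReal.ofReal (wordCoeff (indexWord (List.ofFn s)) N * z ^ N) := by
  have h := tsum_mul_tupleWeight k s hs fun N => ENNReal.ofReal (z ^ N)
  have h2 : ∀ N, ENNReal.ofReal (wordCoeff (indexWord (List.ofFn s)) N * z ^ N) =
      ENNReal.ofReal (z ^ N) * ENNReal.ofReal (wordCoeff (indexWord (List.ofFn s)) N) := by
    intro N
    rw [mul_comm, ENNReal.ofReal_mul (by positivity)]
  simp_rw [h2]
  rw [← h]
  have h3 : ∀ n : Fin (k + 1) → ℕ, ENNReal.ofReal (z ^ n 0) * tupleWeight s n =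
      (decreasingTuples k).indicator
        (fun n => ENNReal.ofReal (z ^ n 0 / ∏ i, (n i : ℝ) ^ s i)) n := by
    classical
    intro n
    simp only [tupleWeight, Set.indicator_apply]
    split_ifs
    · rw [← ENNReal.ofReal_mul (by positivity), mul_one_div]
    · simp
  simp_rw [h3]
  exact tsum_subtype (decreasingTuples k) fun n => ENNReal.ofReal (z ^ n 0 / ∏ i, (n i : ℝ) ^ s i)

theorem polylogTerm_nonneg {k : ℕ} (s : Fin (k + 1) → ℕ) {z : ℝ} (hz : 0 ≤ z)
    (n : decreasingTuples k) : 0 ≤ polylogTerm s z n := by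
  unfold polylogTerm; positivity

theorem hasSum_polylogTerm {k : ℕ} (s : Fin (k + 1) → ℕ) (hs : ∀ i, 1 ≤ s i) {z : ℝ} (hz : 0 ≤ z)
    (h : Summable fun n => wordCoeff (indexWord (List.ofFn s)) n * z ^ n) :
    HasSum (polylogTerm s z) (wordPolylog (indexWord (List.ofFn s)) z) := by
  have h0 : ∀ n, 0 ≤ wordCoeff (indexWord (List.ofFn s)) n * z ^ n := fun n =>
    mul_nonneg (wordCoeff_nonneg _ _) (pow_nonneg hz n)
  have h1 := tsum_ofReal_polylogTerm s hs hz
  rw [← ENNReal.ofReal_tsum_of_nonneg h0 h] at h1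
  have h2 := ENNReal.hasSum_toReal (h1.trans_ne ENNReal.ofReal_ne_top)
  rw [← ENNReal.tsum_toReal_eq fun _ => ENNReal.ofReal_ne_top, h1,
    ENNReal.toReal_ofReal (tsum_nonneg h0)] at h2
  simpa only [wordPolylog, ENNReal.toReal_ofReal (polylogTerm_nonneg s hz _)] using h2

theorem hasSum_polylogTerm_one_half {k : ℕ} (s : Fin (k + 1) → ℕ) (hs : ∀ i, 1 ≤ s i) :
    HasSum (polylogTerm s (1 / 2)) (wordPolylog (indexWord (List.ofFn s)) (1 / 2)) :=
  hasSum_polylogTerm s hs (by norm_num)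
    (summable_wordCoeff_mul_pow _ (by rw [abs_of_pos] <;> norm_num)).of_norm

theorem deltaValue_eq {k : ℕ} (s : Fin (k + 1) → ℕ) (hs : ∀ i, 1 ≤ s i) :
    deltaValue s = wordPolylog (indexWord (List.ofFn s)) (1 / 2) :=
  (hasSum_polylogTerm_one_half s hs).tsum_eq

theorem hasSum_mzvTerm {k : ℕ} (s : Fin (k + 1) → ℕ) (h2 : 2 ≤ s 0) (hs : ∀ i, 1 ≤ s i) :
    HasSum (mzvTerm s) (∑' n, wordCoeff (indexWord (List.ofFn s)) n) := by
  have h1 : mzvTerm s = polylogTerm s 1 := by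
    funext n; simp [mzvTerm, polylogTerm]
  have h3 : Summable (wordCoeff (indexWord (List.ofFn s))) := by
    obtain ⟨a, ha⟩ := Nat.exists_eq_add_of_le' h2
    rw [List.ofFn_succ, ha, indexWord, Nat.add_sub_assoc (by norm_num), List.replicate_succ]
    exact summable_wordCoeff_false_cons _
  rw [h1]
  simpa [wordPolylog] using hasSum_polylogTerm s hs zero_le_one (by simpa using h3)

theorem multiZeta_eq {k : ℕ} (s : Fin (k + 1) → ℕ) (h2 : 2 ≤ s 0) (hs : ∀ i, 1 ≤ s i) :
    multiZeta s = ∑' n, wordCoeff (indexWord (List.ofFn s)) n :=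
  (hasSum_mzvTerm s h2 hs).tsum_eq

/-! ### Evaluation at 1/2 and the final identity -/

theorem wordPolylog_true_one_half : wordPolylog [true] (1 / 2) = Real.log 2 := by
  have h := Real.hasSum_pow_div_log_of_abs_lt_one (x := 1 / 2) (by rw [abs_of_pos] <;> norm_num)
  have h1 : HasSum (fun n => wordCoeff [true] n * (1 / 2 : ℝ) ^ n) (-Real.log (1 - 1 / 2)) := by
    rw [← hasSum_nat_add_iff' 1]
    simpa [wordCoeff, div_eq_mul_inv, mul_comm] using h
  rw [wordPolylog, h1.tsum_eq, ← Real.log_inv]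
  norm_num

theorem mainTheorem2 :
    (∀ (k : ℕ) (s : Fin (k + 1) → ℕ), 2 ≤ s 0 → (∀ i, 1 ≤ s i) → Summable (mzvTerm s)) ∧
    (∀ (k : ℕ) (s : Fin (k + 1) → ℕ), (∀ i, 1 ≤ s i) → Summable (polylogTerm s (1 / 2))) ∧
    3 * multiZeta ![4, 1] + multiZeta ![3, 2] =
      deltaValue ![3, 2] + 3 * deltaValue ![4, 1]
        + (1 / 2 * deltaValue ![2] ^ 2 + deltaValue ![3, 1]) * Real.log 2
        + (1 / 2 * Real.log 2 ^ 2 + multiZeta ![2]) * deltaValue ![2, 1]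
        - 3 * deltaValue ![3, 1, 1] - 2 * deltaValue ![2, 2, 1] - deltaValue ![2, 1, 2]
        + 1 / 4 * multiZeta ![2] * Real.log 2 ^ 3 := by
  refine ⟨fun k s h2 hs => (hasSum_mzvTerm s h2 hs).summable,
    fun k s hs => (hasSum_polylogTerm_one_half s hs).summable, ?_⟩
  have shuffle : ∀ u v, ConvergentAtZero u → ConvergentAtZero v →
      wordPolylog u (1 / 2) * wordPolylog v (1 / 2) =
        ((wordShuffle u v).map (wordPolylog · (1 / 2))).sum := fun u v hu hv =>
    wordPolylog_mul_wordPolylog u v hu hv (by norm_num) (by norm_num)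
  have convolution : ∀ v, ConvergentAtZero (false :: v) →
      ∑' n, wordCoeff (false :: v) n = wordConvolution [] (false :: v) (1 / 2) := fun v hv =>
    (wordConvolution_eq_tsum v hv (by norm_num) (by norm_num)).symm
  have half : (1 : ℝ) - 1 / 2 = 1 / 2 := by norm_num
  have z41 := convolution [false, false, true, true] rfl
  have z32 := convolution [false, true, false, true] rfl
  have z2 := convolution [true] rfl
  have s1 := shuffle [false, true] [false, true, true] rfl rfl
  have s2 := shuffle [false, true] [false, true] rfl rfl
  have s3 := shuffle [false, true] [true, true] rfl rfl
  have s4 := shuffle [true] [true, false, true] rfl rfl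
  have s5 := shuffle [true] [true] rfl rfl
  have s6 := shuffle [true] [true, true] rfl rfl
  simp only [wordConvolution, wordPolylog_nil, half, Bool.not_false, Bool.not_true,
    wordPolylog_true_one_half] at z41 z32 z2
  simp only [wordShuffle, List.map_cons, List.map_nil, List.cons_append, List.nil_append,
    List.sum_cons, List.sum_nil, wordPolylog_true_one_half] at s1 s2 s3 s4 s5 s6
  -- By `s5` and `s6`, (ln 2)² is twice the value of the word of two letters `true`, and ln 2 times
  -- that value is three times the value for three letters.
  have h11 : wordPolylog [true, true] (1 / 2) = Real.log 2 ^ 2 / 2 := by linarith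
  rw [h11] at z41 z32 s3 s6
  have h111 : wordPolylog [true, true, true] (1 / 2) = Real.log 2 ^ 3 / 6 := by linarith
  rw [h111] at z41
  replace z41 := (multiZeta_eq ![4, 1] (by decide) (by decide)).trans z41
  replace z32 := (multiZeta_eq ![3, 2] (by decide) (by decide)).trans z32
  replace z2 := (multiZeta_eq ![2] (by decide) (by decide)).trans z2
  have d32 : deltaValue ![3, 2] = wordPolylog [false, false, true, false, true] (1 / 2) :=
    deltaValue_eq _ (by decide)
  have d41 : deltaValue ![4, 1] = wordPolylog [false, false, false, true, true] (1 / 2) :=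
    deltaValue_eq _ (by decide)
  have d2 : deltaValue ![2] = wordPolylog [false, true] (1 / 2) :=
    deltaValue_eq _ (by decide)
  have d31 : deltaValue ![3, 1] = wordPolylog [false, false, true, true] (1 / 2) :=
    deltaValue_eq _ (by decide)
  have d21 : deltaValue ![2, 1] = wordPolylog [false, true, true] (1 / 2) :=
    deltaValue_eq _ (by decide)
  have d311 : deltaValue ![3, 1, 1] = wordPolylog [false, false, true, true, true] (1 / 2) :=
    deltaValue_eq _ (by decide)
  have d221 : deltaValue ![2, 2, 1] = wordPolylog [false, true, false, true, true] (1 / 2) :=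
    deltaValue_eq _ (by decide)
  have d212 : deltaValue ![2, 1, 2] = wordPolylog [false, true, true, false, true] (1 / 2) :=
    deltaValue_eq _ (by decide)
  rw [z41, z32, z2, d32, d41, d2, d31, d21, d311, d221, d212]
  -- `s1` expands δ₂δ₂₁ and `s2` expands δ₂². The relations `s3` and `s4` eliminate the words absent
  -- from the statement: those of the indices (2,1,1), (1,2,1), (1,1,2) and (1,2).
  linear_combination -s1 - Real.log 2 / 2 * s2 - Real.log 2 * s3 + Real.log 2 / 2 * s4
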